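/- Throughout, $\mathbb{N}=\{0,1,2,\dots\}$ and graphs are finite, simple and have at least one vertex; $\delta(G)$ denotes the minimum degree of a graph $G$. A $k$-edge-coloured graph is a graph $G$ together with an arbitrary map $\phi\colon E(G)\to\{1,\dots,k\}$. A subgraph of $G$ is monochromatic if all its edges receive the same colour under $\phi$. Theorem. There exists a function $f\colon\mathbb{N}^2\to\mathbb{N}$ such that, for all $k,d\in\mathbb{N}$, every $k$-edge-coloured graph $G$ with $\delta(G)\ge f(k,d)$ contains a monochromatic induced subgraph $H$ with $\delta(H)\ge d$. -/

import Mathlib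

/-- A subgraph `H` of an edge-coloured graph `G` is monochromatic if all its edges receive the same
colour (vacuously so when `H` has no edge). A `k`-edge-colouring of `G` is a
`G.EdgeLabeling (Fin k)`, that is, an arbitrary function from the edges of `G` to `Fin k`. -/
def IsMonochromaticSubgraph {V K : Type*} {G : SimpleGraph V} (φ : G.EdgeLabeling K)
    (H : G.Subgraph) : Prop :=
  ∀ (e e' : Sym2 V) (he : e ∈ H.edgeSet) (he' : e' ∈ H.edgeSet),
    φ ⟨e, H.edgeSet_subset he⟩ = φ ⟨e', H.edgeSet_subset he'⟩

section InducedMonochromatic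

open Finset Classical

universe u

namespace SimpleGraph

/-! A clique on `d + 1` vertices within one colour is already a solution. Otherwise Ramsey's theorem
makes every large vertex set contain large independent sets of `G`. Choose `W` of maximal average
degree: it is `δ`-degenerate, and a positive proportion `L` of its vertices have degree of order
`δ`, with many neighbours along one common colour `i`.

Select `B ⊆ W` at random with probability of order `1 / δ`, and let `A ⊆ L` consist of the
unselected vertices whose neighbours in `B` form an independent set of `2 * d` vertices, all joined
by colour `i` and with no out-neighbour in `B` in a bounded-out-degree orientation. Supersaturation
(`exists_pow_le_mul_card_indepSubsets`) keeps a constant proportion of `L` in `A` on average, so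
`#A` is at least a constant times `δ * #B` (`exists_selection`). A greedy independent subset of `A`
could be too small by a constant factor; `exists_large_isIndepSet` gains that factor and gives `A'`
with `#B ≤ #A'`. The vertices of `B` without out-neighbours in `B` are independent too, so an
induced bipartite graph in colour `i` of large average degree results. -/

/-! ### Ramsey's theorem -/

/-- Multicolour Ramsey theorem for a family of graphs that together cover all pairs. -/
theorem exists_isClique_of_covering {ι : Type*} [Fintype ι] (t : ι → ℕ) :
    ∃ R : ℕ, ∀ (V : Type u) (F : ι → SimpleGraph V),
      (∀ u v, u ≠ v → ∃ i, (F i).Adj u v) → ∀ T : Finset V, R ≤ #T →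
        ∃ i, ∃ S ⊆ T, #S = t i ∧ (F i).IsClique (S : Set V) := by
  induction hm : ∑ i, t i generalizing t with
  | zero =>
    -- All targets are zero, so the empty set will do; two vertices are needed only to produce an
    -- index.
    refine ⟨2, fun V F hF T hT => ?_⟩
    obtain ⟨a, ha, b, hb, hab⟩ := one_lt_card.mp hT
    obtain ⟨i, -⟩ := hF a b hab
    exact ⟨i, ∅, empty_subset _, by simp [sum_eq_zero_iff.mp hm i (mem_univ i)], by simp⟩
  | succ m ih =>
    by_cases h0 : ∃ i, t i = 0
    · obtain ⟨i, hi⟩ := h0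
      exact ⟨0, fun V F hF T hT => ⟨i, ∅, empty_subset _, by simp [hi], by simp⟩⟩
    push Not at h0
    have key : ∀ i, ∑ j, Function.update t i (t i - 1) j = m := by
      intro i
      have h1 := sum_update_of_mem (mem_univ i) t (t i - 1)
      rw [sdiff_singleton_eq_erase] at h1
      have h2 := add_sum_erase univ t (mem_univ i)
      have := h0 i
      omega
    choose R hR using fun i => ih _ (key i)
    refine ⟨∑ i, R i + 1, fun V F hF T hT => ?_⟩
    obtain ⟨v, hv⟩ : T.Nonempty := card_pos.mp (by omega)
    obtain ⟨i, hi⟩ : ∃ i, R i ≤ #{u ∈ T | (F i).Adj v u} := by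
      by_contra! hcon
      have h1 : T.erase v ⊆ univ.biUnion fun i => {u ∈ T | (F i).Adj v u} := by
        intro u hu
        obtain ⟨i, hi⟩ := hF v u (ne_of_mem_erase hu).symm
        simp only [mem_biUnion, mem_filter, mem_univ, true_and]
        exact ⟨i, mem_of_mem_erase hu, hi⟩
      have h2 := (card_le_card h1).trans card_biUnion_le
      have h3 : ∑ i, #{u ∈ T | (F i).Adj v u} ≤ ∑ i, R i := sum_le_sum fun i _ => (hcon i).le
      have h4 := card_erase_add_one hv
      have h5 : ∑ i, R i ≤ #(T.erase v) := by omega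
      rcases isEmpty_or_nonempty ι with hι | ⟨⟨i⟩⟩
      · simp at hm
      · have : ∑ i, #{u ∈ T | (F i).Adj v u} < ∑ i, R i :=
          sum_lt_sum_of_nonempty ⟨i, mem_univ i⟩ fun i _ => hcon i
        omega
    obtain ⟨j, S, hST, hcard, hS⟩ := hR i V F hF _ hi
    have hST' : S ⊆ T := hST.trans (filter_subset _ _)
    by_cases hj : j = i
    · subst hj
      have hadj : ∀ u ∈ S, (F j).Adj v u := fun u hu => (mem_filter.mp (hST hu)).2
      refine ⟨j, insert v S, insert_subset hv hST', ?_, ?_⟩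
      · rw [card_insert_of_notMem fun h => (hadj v h).ne rfl, hcard, Function.update_self]
        have := h0 j
        omega
      · rw [coe_insert]
        exact hS.insert fun u hu _ => hadj u hu
    · exact ⟨j, S, hST', by rw [hcard, Function.update_of_ne hj], hS⟩

variable {V : Type u}

/-! ### Counting independent sets -/

/-- Every set of at least `R` vertices contains an independent set of size `t`. -/
def HasIndepSets (G : SimpleGraph V) (R t : ℕ) : Prop :=
  ∀ X : Finset V, R ≤ #X → ∃ Y ⊆ X, #Y = t ∧ G.IsIndepSet (Y : Set V)

/-- The independent subsets of a finite set of vertices. -/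
noncomputable def indepSubsets (G : SimpleGraph V) (X : Finset V) : Finset (Finset V) :=
  {Y ∈ X.powerset | G.IsIndepSet (Y : Set V)}

theorem mem_indepSubsets {G : SimpleGraph V} {X Y : Finset V} :
    Y ∈ G.indepSubsets X ↔ Y ⊆ X ∧ G.IsIndepSet (Y : Set V) := by
  simp [indepSubsets]

/-- Double counting of pairs `Y ⊆ Z` with `Z` an `R`-subset of `X`: each `Z` contains an independent
`t`-set, and a given `Y` lies in only `(#X - t).choose (R - t)` sets `Z`. -/
theorem choose_le_card_indepSubsets {G : SimpleGraph V} {R t : ℕ} (h : G.HasIndepSets R t)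
    {X : Finset V} (hX : R ≤ #X) (ht : t ≤ R) :
    (#X).choose t ≤ #{Y ∈ G.indepSubsets X | #Y = t} * R.choose t := by
  have h1 : (#X).choose R ≤ #{Y ∈ G.indepSubsets X | #Y = t} * (#X - t).choose (R - t) := by
    rw [← card_powersetCard R X]
    have hsub : X.powersetCard R ⊆
        {Y ∈ G.indepSubsets X | #Y = t}.biUnion fun Y => {Z ∈ X.powersetCard R | Y ⊆ Z} := by
      intro Z hZ
      obtain ⟨hZX, hZc⟩ := mem_powersetCard.mp hZ
      obtain ⟨Y, hYZ, hYc, hY⟩ := h Z hZc.ge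
      simp only [mem_biUnion, mem_filter]
      exact ⟨Y, ⟨mem_indepSubsets.mpr ⟨hYZ.trans hZX, hY⟩, hYc⟩, hZ, hYZ⟩
    refine (card_le_card hsub).trans (card_biUnion_le_card_mul _ _ _ fun Y hY => ?_)
    obtain ⟨hY, hYc⟩ := mem_filter.mp hY
    have hYX := (mem_indepSubsets.mp hY).1
    have : #X - t = #(X \ Y) := by rw [card_sdiff_of_subset hYX, hYc]
    rw [this, ← card_powersetCard]
    refine card_le_card_of_injOn (fun Z => Z \ Y) ?_ ?_
    · intro Z hZ
      simp only [coe_filter, mem_powersetCard, Set.mem_ofPred_eq] at hZ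
      simp only [mem_coe, mem_powersetCard]
      exact ⟨sdiff_subset_sdiff hZ.1.1 le_rfl, by rw [card_sdiff_of_subset hZ.2, hZ.1.2, hYc]⟩
    · intro Z hZ Z' hZ' hZZ
      simp only [coe_filter, mem_powersetCard, Set.mem_ofPred_eq] at hZ hZ'
      have := congrArg (· ∪ Y) hZZ
      simpa [sdiff_union_of_subset hZ.2, sdiff_union_of_subset hZ'.2] using this
  have h2 := Nat.choose_mul (n := #X) (k := R) (s := t) ht
  have hpos : 0 < (#X - t).choose (R - t) := Nat.choose_pos (by omega)
  refine Nat.le_of_mul_le_mul_right ?_ hpos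
  calc (#X).choose t * (#X - t).choose (R - t) = (#X).choose R * R.choose t := h2.symm
    _ ≤ _ := Nat.mul_le_mul_right _ h1
    _ = _ := by ring

/-- Supersaturation: a positive proportion of the `t`-subsets is independent, with a constant
depending only on `R` and `t`. -/
theorem exists_pow_le_mul_card_indepSubsets (R t : ℕ) :
    ∃ c > 0, ∃ M, ∀ {V : Type u} {G : SimpleGraph V}, G.HasIndepSets R t →
      ∀ X : Finset V, M ≤ #X → (#X) ^ t ≤ c * #{Y ∈ G.indepSubsets X | #Y = t} := by
  by_cases ht : t ≤ R
  · refine ⟨2 ^ t * t.factorial * R.choose t, by have := Nat.choose_pos ht; positivity,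
      R + 2 * t, fun {V G} h X hX => ?_⟩
    have h1 : (#X) ^ t ≤ 2 ^ t * (t.factorial * (#X).choose t) := by
      have h2 : (#X + 1 - t) ^ t ≤ t.factorial * (#X).choose t := by
        rw [← Nat.descFactorial_eq_factorial_mul_choose]
        exact Nat.pow_sub_le_descFactorial _ _
      calc (#X) ^ t ≤ (2 * (#X + 1 - t)) ^ t := Nat.pow_le_pow_left (by omega) t
        _ = 2 ^ t * (#X + 1 - t) ^ t := mul_pow _ _ _
        _ ≤ _ := Nat.mul_le_mul_left _ h2
    calc (#X) ^ t ≤ 2 ^ t * (t.factorial * (#X).choose t) := h1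
      _ ≤ 2 ^ t * (t.factorial * (#{Y ∈ G.indepSubsets X | #Y = t} * R.choose t)) := by
        gcongr
        exact choose_le_card_indepSubsets h (by omega) ht
      _ = _ := by ring
  · refine ⟨1, one_pos, R, fun {V G} h X hX => ?_⟩
    obtain ⟨X', hX', hc⟩ := exists_subset_card_eq hX
    obtain ⟨Y, hY, hYc, -⟩ := h X' hc.ge
    have := card_le_card hY
    omega

/-- On large sets, a uniformly random independent subset is large on average. -/
theorem exists_mul_card_indepSubsets_le_sum_card (R t : ℕ) (ht : t ≠ 0) :
    ∃ M, ∀ {V : Type u} {G : SimpleGraph V}, G.HasIndepSets R t →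
      ∀ X : Finset V, M ≤ #X →
        t * #(G.indepSubsets X) ≤ 2 * ∑ Y ∈ G.indepSubsets X, #Y := by
  obtain ⟨s, rfl⟩ := Nat.exists_eq_succ_of_ne_zero ht
  obtain ⟨c, hc, M, hM⟩ := exists_pow_le_mul_card_indepSubsets.{u} R (s + 1)
  -- Once `#X ≥ c * (s + 1)`, the independent `(s + 1)`-sets outnumber all smaller sets, so at least
  -- half of the independent sets have size at least `s + 1`.
  refine ⟨M + c * (s + 1) + 1, fun {V G} h X hX => ?_⟩
  set I := G.indepSubsets X with hI
  have h1 := hM h X (by omega)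
  have hsmall : #{Y ∈ I | #Y < s + 1} ≤ (s + 1) * (#X) ^ s := by
    have hsub : {Y ∈ I | #Y < s + 1} ⊆ (range (s + 1)).biUnion fun j => X.powersetCard j := by
      intro Y hY
      obtain ⟨hY, hYc⟩ := mem_filter.mp hY
      simp only [mem_biUnion, mem_range, mem_powersetCard]
      exact ⟨_, hYc, (mem_indepSubsets.mp hY).1, rfl⟩
    refine (card_le_card hsub).trans ?_
    have := card_biUnion_le_card_mul (range (s + 1)) (fun j => X.powersetCard j) ((#X) ^ s) ?_
    · simpa using this
    · intro j hj
      rw [card_powersetCard]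
      exact (Nat.choose_le_pow _ _).trans
        (Nat.pow_le_pow_right (by omega) (by simp at hj; omega))
  have hlarge : (s + 1) * (#X) ^ s ≤ #{Y ∈ I | ¬ #Y < s + 1} := by
    have h2 : #{Y ∈ I | #Y = s + 1} ≤ #{Y ∈ I | ¬ #Y < s + 1} :=
      card_le_card (monotone_filter_right _ fun Y _ hY => by simp_all)
    refine Nat.le_of_mul_le_mul_left (le_trans ?_ (h1.trans (Nat.mul_le_mul_left c h2))) hc
    rw [pow_succ, ← mul_assoc, mul_comm]
    exact Nat.mul_le_mul_left _ (by omega)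
  have hsplit := card_filter_add_card_filter_not (s := I) (fun Y => #Y < s + 1)
  have hsum : (s + 1) * #{Y ∈ I | ¬ #Y < s + 1} ≤ ∑ Y ∈ I, #Y := by
    calc (s + 1) * #{Y ∈ I | ¬ #Y < s + 1} = ∑ Y ∈ I with ¬ #Y < s + 1, (s + 1) := by
          simp [mul_comm]
      _ ≤ ∑ Y ∈ I with ¬ #Y < s + 1, #Y := sum_le_sum fun Y hY => by
          have := (mem_filter.mp hY).2
          omega
      _ ≤ _ := sum_le_sum_of_subset (filter_subset _ _)
  calc (s + 1) * #I ≤ (s + 1) * (2 * #{Y ∈ I | ¬ #Y < s + 1}) :=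
        Nat.mul_le_mul_left _ (by omega)
    _ = 2 * ((s + 1) * #{Y ∈ I | ¬ #Y < s + 1}) := by ring
    _ ≤ _ := Nat.mul_le_mul_left _ hsum

/-! ### Independent sets beyond the greedy bound -/

/-- The neighbours of `v` lying in the finite set `T`. -/
noncomputable def nbrsIn (G : SimpleGraph V) (T : Finset V) (v : V) : Finset V := {u ∈ T | G.Adj v u}

theorem mem_nbrsIn {G : SimpleGraph V} {T : Finset V} {u v : V} :
    u ∈ G.nbrsIn T v ↔ u ∈ T ∧ G.Adj v u := by
  simp [nbrsIn]

theorem nbrsIn_subset (G : SimpleGraph V) (T : Finset V) (v : V) : G.nbrsIn T v ⊆ T :=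
  filter_subset _ _

theorem nbrsIn_mono (G : SimpleGraph V) {S T : Finset V} (h : S ⊆ T) (v : V) :
    G.nbrsIn S v ⊆ G.nbrsIn T v :=
  filter_subset_filter _ h

theorem sum_card_nbrsIn_comm (G : SimpleGraph V) (S T : Finset V) :
    ∑ v ∈ S, #(G.nbrsIn T v) = ∑ u ∈ T, #(G.nbrsIn S u) := by
  have := sum_card_bipartiteAbove_eq_sum_card_bipartiteBelow G.Adj (s := S) (t := T)
  simpa [bipartiteAbove, bipartiteBelow, nbrsIn, G.adj_comm] using this

/-- The independent subsets `I` of `A` with a prescribed trace `J` outside the closed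
neighbourhood of `v` are `J ∪ {v}` and the sets `J ∪ Y`, with `Y` an independent set of neighbours
of `v` that are not adjacent to `J`. -/
theorem sum_fiber_indepSubsets (G : SimpleGraph V) {A : Finset V} {v : V} (hv : v ∈ A)
    {J : Finset V} (hJ : J ∈ (G.indepSubsets A).image fun I => I \ insert v (G.nbrsIn A v))
    (g : Finset V → ℕ) :
    ∑ I ∈ G.indepSubsets A with I \ insert v (G.nbrsIn A v) = J, g I =
      g (insert v J) + ∑ Y ∈ G.indepSubsets {u ∈ G.nbrsIn A v | ∀ w ∈ J, ¬ G.Adj w u}, g (J ∪ Y) := by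
  set N := G.nbrsIn A v with hN
  set X := {u ∈ N | ∀ w ∈ J, ¬ G.Adj w u} with hX
  obtain ⟨I₀, hI₀, hIJ⟩ := mem_image.mp hJ
  have hI₀' := mem_indepSubsets.mp hI₀
  have hJA : J ⊆ A := hIJ ▸ sdiff_subset.trans hI₀'.1
  have hJi : ∀ a ∈ J, ∀ b ∈ J, ¬ G.Adj a b := fun a ha b hb hab =>
    hI₀'.2 (mem_coe.mpr (sdiff_subset (hIJ ▸ ha))) (mem_coe.mpr (sdiff_subset (hIJ ▸ hb))) hab.ne hab
  have hJv : v ∉ J := fun h => by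
    rw [← hIJ] at h
    simp at h
  have hJN : ∀ a ∈ J, ¬ G.Adj v a := fun a ha hadj => by
    have hA := hJA ha
    rw [← hIJ] at ha
    simp [hN, mem_nbrsIn, hA, hadj] at ha
  have hXJ : ∀ Y ⊆ X, Disjoint Y J := fun Y hY => Finset.disjoint_left.mpr fun a ha ha' =>
    hJN a ha' (mem_nbrsIn.mp (mem_filter.mp (hY ha)).1).2
  have hfib : {I ∈ G.indepSubsets A | I \ insert v N = J} =
      insert (insert v J) ((G.indepSubsets X).image fun Y => J ∪ Y) := by
    ext I
    simp only [mem_filter, mem_insert, mem_image, mem_indepSubsets]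
    constructor
    · rintro ⟨⟨hIA, hI⟩, hIv⟩
      by_cases hvI : v ∈ I
      · left
        ext a
        have h1 : a ∈ I → a ∉ N := fun ha haN =>
          hI (mem_coe.mpr hvI) (mem_coe.mpr ha) (mem_nbrsIn.mp haN).2.ne (mem_nbrsIn.mp haN).2
        rw [← hIv]
        simp only [mem_insert, mem_sdiff]
        by_cases hav : a = v
        · simp [hav, hvI]
        · simp only [hav, false_or]
          tauto
      · right
        refine ⟨I ∩ N, ⟨?_, ?_⟩, ?_⟩
        · intro a ha
          obtain ⟨haI, haN⟩ := mem_inter.mp ha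
          refine mem_filter.mpr ⟨haN, fun w hw hadj => ?_⟩
          rw [← hIv] at hw
          exact hI (mem_coe.mpr (sdiff_subset hw)) (mem_coe.mpr haI) hadj.ne hadj
        · exact hI.mono (by simp)
        · ext a
          rw [← hIv]
          simp only [mem_union, mem_sdiff, mem_insert, mem_inter]
          by_cases hav : a = v
          · subst hav
            simp [hvI]
          · simp only [hav, false_or]
            tauto
    · rintro (rfl | ⟨Y, ⟨hYX, hY⟩, rfl⟩)
      · refine ⟨⟨insert_subset hv hJA, ?_⟩, ?_⟩
        · intro a ha b hb _ hab
          rcases mem_insert.mp (mem_coe.mp ha) with rfl | ha'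
          · rcases mem_insert.mp (mem_coe.mp hb) with rfl | hb'
            · exact hab.ne rfl
            · exact hJN b hb' hab
          · rcases mem_insert.mp (mem_coe.mp hb) with rfl | hb'
            · exact hJN a ha' hab.symm
            · exact hJi a ha' b hb' hab
        · ext a
          simp only [mem_sdiff, mem_insert]
          constructor
          · tauto
          · intro ha
            refine ⟨Or.inr ha, ?_⟩
            rintro (rfl | h)
            · exact hJv ha
            · exact hJN a ha (mem_nbrsIn.mp h).2
      · have hYN : Y ⊆ N := hYX.trans (filter_subset _ _)
        refine ⟨⟨union_subset hJA (hYN.trans (nbrsIn_subset _ _ _)), ?_⟩, ?_⟩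
        · intro a ha b hb hne hab
          rcases mem_union.mp (mem_coe.mp ha) with ha | ha
          · rcases mem_union.mp (mem_coe.mp hb) with hb | hb
            · exact hJi a ha b hb hab
            · exact (mem_filter.mp (hYX hb)).2 a ha hab
          · rcases mem_union.mp (mem_coe.mp hb) with hb | hb
            · exact (mem_filter.mp (hYX ha)).2 b hb hab.symm
            · exact hY (mem_coe.mpr ha) (mem_coe.mpr hb) hne hab
        · ext a
          simp only [mem_sdiff, mem_insert, mem_union]
          constructor
          · rintro ⟨ha | ha, hna⟩
            · exact ha
            · exact absurd (Or.inr (hYN ha)) hna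
          · intro ha
            refine ⟨Or.inl ha, ?_⟩
            rintro (rfl | h)
            · exact hJv ha
            · exact hJN a ha (mem_nbrsIn.mp h).2
  rw [hfib, sum_insert, sum_image]
  · intro Y hY Y' hY' hYY
    have h1 := hXJ Y (mem_indepSubsets.mp hY).1
    have h2 := hXJ Y' (mem_indepSubsets.mp hY').1
    have := congrArg (· \ J) hYY
    simpa [union_sdiff_distrib, sdiff_eq_self_of_disjoint h1, sdiff_eq_self_of_disjoint h2]
      using this
  · intro h
    obtain ⟨Y, hY, hYJ⟩ := mem_image.mp h
    have : v ∈ J ∪ Y := hYJ ▸ mem_insert_self v J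
    rcases mem_union.mp this with h | h
    · exact hJv h
    · exact (mem_nbrsIn.mp (mem_filter.mp ((mem_indepSubsets.mp hY).1 h)).1).2.ne rfl

/-- A set of maximum degree at most `Δ` in a graph satisfying `HasIndepSets` has an independent
subset larger than the greedy bound by any prescribed factor, once `Δ` is large. -/
theorem exists_large_isIndepSet (R K : ℕ) (hK : K ≠ 0) :
    ∃ Δ₀, ∀ {V : Type u} {G : SimpleGraph V}, G.HasIndepSets R (4 * K) →
      ∀ Δ ≥ Δ₀, ∀ A : Finset V, (∀ v ∈ A, #(G.nbrsIn A v) ≤ Δ) →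
        ∃ I ⊆ A, G.IsIndepSet (I : Set V) ∧ K * #A ≤ 2 * Δ * #I := by
  obtain ⟨M, hM⟩ := exists_mul_card_indepSubsets_le_sum_card.{u} R (4 * K) (by omega)
  refine ⟨K * (1 + 2 ^ M), fun {V G} h Δ hΔ A hA => ?_⟩
  -- Large `X`: the average of `#Y` is at least `2 * K`. Small `X`: there are at most `2 ^ M` sets
  -- `Y`, and the term `Δ` alone suffices.
  have hfiber : ∀ X : Finset V,
      K * (1 + #(G.indepSubsets X)) ≤ Δ + ∑ Y ∈ G.indepSubsets X, #Y := by
    intro X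
    rcases le_or_gt M #X with hX | hX
    · have h1 := hM h X hX
      have h2 : 1 ≤ #(G.indepSubsets X) :=
        card_pos.mpr ⟨∅, mem_indepSubsets.mpr ⟨empty_subset _, by simp [IsIndepSet]⟩⟩
      nlinarith
    · have : #(G.indepSubsets X) ≤ 2 ^ M := by
        calc #(G.indepSubsets X) ≤ #X.powerset := card_le_card (filter_subset _ _)
          _ = 2 ^ #X := card_powerset X
          _ ≤ 2 ^ M := Nat.pow_le_pow_right (by omega) hX.le
      have : K * (1 + #(G.indepSubsets X)) ≤ K * (1 + 2 ^ M) := by gcongr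
      omega
  set S := G.indepSubsets A with hS
  -- For a uniformly random independent `I`, condition on its trace outside the closed neighbourhood
  -- of `v`; `hfiber` bounds each conditional average.
  have hlow : ∀ v ∈ A, K * #S ≤ ∑ I ∈ S, (Δ * (if v ∈ I then 1 else 0) + #(G.nbrsIn I v)) := by
    intro v hv
    set N := insert v (G.nbrsIn A v) with hN
    have hmap : ∀ I ∈ S, I \ N ∈ S.image fun I => I \ N := fun I hI => mem_image_of_mem _ hI
    rw [← sum_fiberwise_of_maps_to hmap, card_eq_sum_card_fiberwise hmap, mul_sum]
    refine sum_le_sum fun J hJ => ?_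
    rw [card_eq_sum_ones, sum_fiber_indepSubsets G hv hJ, sum_fiber_indepSubsets G hv hJ]
    rw [← card_eq_sum_ones]
    refine (hfiber _).trans (Nat.add_le_add ?_ (sum_le_sum fun Y hY => ?_))
    · simp
    · refine le_add_left (card_le_card fun a ha => ?_)
      have := (mem_nbrsIn.mp (mem_filter.mp ((mem_indepSubsets.mp hY).1 ha)).1).2
      exact mem_nbrsIn.mpr ⟨mem_union_right _ ha, this⟩
  have hup : ∀ I ∈ S, ∑ v ∈ A, (Δ * (if v ∈ I then 1 else 0) + #(G.nbrsIn I v)) ≤ 2 * Δ * #I := by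
    intro I hI
    have hIA := (mem_indepSubsets.mp hI).1
    rw [sum_add_distrib, ← mul_sum, sum_card_nbrsIn_comm]
    have h1 : ∑ v ∈ A, (if v ∈ I then 1 else 0) = #I := by
      rw [sum_boole, filter_mem_eq_inter, inter_eq_right.mpr hIA]
      simp
    have h2 : ∑ u ∈ I, #(G.nbrsIn A u) ≤ #I * Δ := by
      simpa using sum_le_card_nsmul I _ Δ fun u hu => hA u (hIA hu)
    rw [h1]
    linarith
  have hSne : S.Nonempty := ⟨∅, mem_indepSubsets.mpr ⟨empty_subset _, by simp [IsIndepSet]⟩⟩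
  obtain ⟨I, hI, hle⟩ : ∃ I ∈ S, K * #A ≤ 2 * Δ * #I := by
    refine exists_le_of_sum_le hSne ?_
    calc ∑ _I ∈ S, K * #A = ∑ _v ∈ A, K * #S := by simp; ring
      _ ≤ ∑ v ∈ A, ∑ I ∈ S, (Δ * (if v ∈ I then 1 else 0) + #(G.nbrsIn I v)) := sum_le_sum hlow
      _ = ∑ I ∈ S, ∑ v ∈ A, (Δ * (if v ∈ I then 1 else 0) + #(G.nbrsIn I v)) := sum_comm
      _ ≤ ∑ I ∈ S, 2 * Δ * #I := sum_le_sum hup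
  exact ⟨I, (mem_indepSubsets.mp hI).1, (mem_indepSubsets.mp hI).2, hle⟩

/-! ### Density, degeneracy and orientations -/

/-- A subset `W` of maximum average degree `ρ` has minimum degree at least `ρ / 2`. -/
theorem exists_max_density (G : SimpleGraph V) {U : Finset V} (hU : U.Nonempty) :
    ∃ W ⊆ U, W.Nonempty ∧ ∃ ρ : ℝ, (∑ v ∈ W, (#(G.nbrsIn W v) : ℝ) = ρ * #W) ∧
      (∀ T ⊆ U, ∑ v ∈ T, (#(G.nbrsIn T v) : ℝ) ≤ ρ * #T) ∧
      ∀ v ∈ W, ρ ≤ 2 * #(G.nbrsIn W v) := by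
  obtain ⟨W, hW, hmax⟩ := exists_max_image (U.powerset.filter Finset.Nonempty)
    (fun T => (∑ v ∈ T, (#(G.nbrsIn T v) : ℝ)) / #T) ⟨U, by simp [hU]⟩
  simp only [mem_filter, mem_powerset] at hW hmax
  set ρ := (∑ v ∈ W, (#(G.nbrsIn W v) : ℝ)) / #W with hρ
  have hWpos : (0 : ℝ) < #W := by exact_mod_cast hW.2.card_pos
  have hWρ : ∑ v ∈ W, (#(G.nbrsIn W v) : ℝ) = ρ * #W := by
    rw [hρ, div_mul_cancel₀ _ hWpos.ne']
  have hT : ∀ T ⊆ U, ∑ v ∈ T, (#(G.nbrsIn T v) : ℝ) ≤ ρ * #T := by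
    intro T hTU
    rcases T.eq_empty_or_nonempty with rfl | hne
    · simp
    · have := hmax T ⟨hTU, hne⟩
      rwa [div_le_iff₀ (by exact_mod_cast hne.card_pos)] at this
  refine ⟨W, hW.1, hW.2, ρ, hWρ, hT, fun v hv => ?_⟩
  -- Deleting `v` lowers the degree sum by at most twice its degree, and cannot raise the average
  -- above `ρ`.
  have h1 := hT (W.erase v) ((erase_subset _ _).trans hW.1)
  have h2 : ∑ u ∈ W, #(G.nbrsIn W u) ≤
      ∑ u ∈ W.erase v, #(G.nbrsIn (W.erase v) u) + 2 * #(G.nbrsIn W v) := by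
    rw [← add_sum_erase W _ hv, sum_card_nbrsIn_comm G (W.erase v) W,
      ← add_sum_erase W _ hv]
    have := card_le_card (G.nbrsIn_mono (erase_subset v W) v)
    omega
  have h2' : ∑ u ∈ W, (#(G.nbrsIn W u) : ℝ) ≤
      ∑ u ∈ W.erase v, (#(G.nbrsIn (W.erase v) u) : ℝ) + 2 * #(G.nbrsIn W v) := by
    exact_mod_cast h2
  have h3 : (#(W.erase v) : ℝ) = #W - 1 := by
    rw [card_erase_of_mem hv, Nat.cast_sub hW.2.card_pos, Nat.cast_one]
  rw [h3] at h1
  linarith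

theorem exists_le_card_nbrsIn (G : SimpleGraph V) {U : Finset V} (hU : U.Nonempty) {d : ℕ}
    (h : 2 * d * #U ≤ ∑ v ∈ U, #(G.nbrsIn U v)) :
    ∃ W ⊆ U, W.Nonempty ∧ ∀ v ∈ W, d ≤ #(G.nbrsIn W v) := by
  obtain ⟨W, hWU, hW, ρ, -, hT, hmin⟩ := G.exists_max_density hU
  refine ⟨W, hWU, hW, fun v hv => ?_⟩
  have h1 : (2 * d * #U : ℝ) ≤ ρ * #U := le_trans (by exact_mod_cast h) (hT U le_rfl)
  have h2 : (2 * d : ℝ) ≤ ρ := le_of_mul_le_mul_right h1 (by exact_mod_cast hU.card_pos)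
  have h3 := hmin v hv
  have : (d : ℝ) ≤ #(G.nbrsIn W v) := by linarith
  exact_mod_cast this

/-- A `δ`-degenerate graph has an orientation of out-degree at most `δ`. -/
theorem exists_orientation (G : SimpleGraph V) {δ : ℕ} (W : Finset V)
    (h : ∀ T ⊆ W, T.Nonempty → ∃ v ∈ T, #(G.nbrsIn T v) ≤ δ) :
    ∃ o : V → Finset V, (∀ v, #(o v) ≤ δ ∧ ∀ u ∈ o v, G.Adj v u) ∧
      ∀ u ∈ W, ∀ v ∈ W, G.Adj u v → u ∈ o v ∨ v ∈ o u := by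
  induction W using Finset.strongInduction with
  | H W ih =>
    rcases W.eq_empty_or_nonempty with rfl | hne
    · exact ⟨fun _ => ∅, by simp, by simp⟩
    obtain ⟨w, hw, hwδ⟩ := h W le_rfl hne
    obtain ⟨o, ho, hcov⟩ := ih (W.erase w) (erase_ssubset hw)
      fun T hT => h T (hT.trans (erase_subset _ _))
    refine ⟨Function.update o w (G.nbrsIn W w), fun v => ?_, fun u hu v hv huv => ?_⟩
    · by_cases hv : v = w
      · subst hv
        simpa using ⟨hwδ, fun u hu => (mem_nbrsIn.mp hu).2⟩
      · simpa [Function.update_of_ne hv] using ho v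
    · by_cases huw : u = w
      · subst huw
        right
        simpa using mem_nbrsIn.mpr ⟨hv, huv⟩
      by_cases hvw : v = w
      · subst hvw
        left
        simpa using mem_nbrsIn.mpr ⟨hu, huv.symm⟩
      rw [Function.update_of_ne huw, Function.update_of_ne hvw]
      exact hcov u (mem_erase.mpr ⟨huw, hu⟩) v (mem_erase.mpr ⟨hvw, hv⟩) huv

end SimpleGraph

/-! ### Random selection -/

/-- Uniform maps `f` model independent selection, `f u = 0` meaning that `u` is selected. This is
the product formula for selecting all of `S` and none of `F`, cleared of denominators. -/
theorem pow_card_mul_card_filter_fun {V : Type*} [Fintype V] (M : ℕ) {S F : Finset V}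
    (hSF : Disjoint S F) :
    (M + 1) ^ #S * #{f : V → Fin (M + 1) | (∀ u ∈ S, f u = 0) ∧ ∀ u ∈ F, f u ≠ 0} =
      M ^ #F * (M + 1) ^ #Fᶜ := by
  have h1 : ({f : V → Fin (M + 1) | (∀ u ∈ S, f u = 0) ∧ ∀ u ∈ F, f u ≠ 0} : Finset _) =
      Fintype.piFinset fun u => if u ∈ S then {0} else if u ∈ F then {0}ᶜ else univ := by
    ext f
    simp only [mem_filter, mem_univ, true_and, Fintype.mem_piFinset]
    constructor
    · rintro ⟨hS, hF⟩ u
      split_ifs with h h'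
      · simpa using hS u h
      · simpa using hF u h'
      · simp
    · intro h
      refine ⟨fun u hu => ?_, fun u hu => ?_⟩
      · simpa [hu] using h u
      · simpa [hu, Finset.disjoint_right.mp hSF hu] using h u
  have h2 : (M + 1) ^ #S = ∏ u : V, if u ∈ S then M + 1 else 1 := by
    rw [prod_ite_mem, univ_inter, prod_const]
  have h3 : M ^ #F * (M + 1) ^ #Fᶜ = ∏ u : V, if u ∈ F then M else M + 1 := by
    rw [prod_ite, prod_const, prod_const]
    congr 3 <;> ext <;> simp
  rw [h1, Fintype.card_piFinset, h2, h3, ← prod_mul_distrib]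
  refine prod_congr rfl fun u _ => ?_
  by_cases hS : u ∈ S
  · simp [hS, Finset.disjoint_left.mp hSF hS]
  · by_cases hF : u ∈ F
    · simp [hS, hF, card_compl]
    · simp [hS, hF]

/-- Bernoulli's inequality: `q` given vertices all remain unselected with probability at least `1 /
2`. -/
theorem pow_le_two_mul_pow_of_two_mul_le {M q : ℕ} (h : 2 * q ≤ M + 1) :
    (M + 1) ^ q ≤ 2 * M ^ q := by
  have hb := one_add_mul_le_pow (a := -(1 / (M + 1 : ℝ))) (by
    have : 1 / (M + 1 : ℝ) ≤ 1 := by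
      rw [div_le_one (by positivity)]
      linarith [(Nat.cast_nonneg M : (0 : ℝ) ≤ M)]
    linarith) q
  have h1 : (2 * q : ℝ) ≤ M + 1 := by exact_mod_cast h
  have h2 : 1 + -(1 / (M + 1 : ℝ)) = M / (M + 1) := by
    field_simp
    ring
  have h3 : (q : ℝ) * (1 / (M + 1)) ≤ 1 / 2 := by
    rw [mul_one_div, div_le_div_iff₀ (by positivity) (by norm_num)]
    linarith
  rw [h2, div_pow] at hb
  have h4 : (1 / 2 : ℝ) ≤ M ^ q / (M + 1) ^ q := by linarith
  rw [div_le_div_iff₀ (by norm_num) (by positivity)] at h4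
  have : ((M + 1) ^ q : ℝ) ≤ 2 * M ^ q := by linarith
  exact_mod_cast this

/-- A random selection of `W` with probability `1 / (M + 1)`, in the form in which it is used: each
`v ∈ L` comes with a large family of `s`-sets `S`, and `v` survives if some `S` is selected in full
while nothing of the small set `F v S` is. -/
theorem exists_selection {V : Type*} [Fintype V] {W L : Finset V} (hL : L.Nonempty) {M s C a : ℕ}
    (𝒮 : V → Finset (Finset V)) (F : V → Finset V → Finset V)
    (hs : ∀ v ∈ L, ∀ S ∈ 𝒮 v, #S = s ∧ S ⊆ W ∧ Disjoint S (F v S) ∧ 2 * #(F v S) ≤ M + 1)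
    (hF : ∀ v ∈ L, ∀ S ∈ 𝒮 v, ∀ S' ∈ 𝒮 v, S' \ S ⊆ F v S)
    (hC : ∀ v ∈ L, (M + 1) ^ s ≤ C * #(𝒮 v)) (ha : 0 < a) (hW : #W ≤ a * #L) :
    ∃ B ⊆ W, ∃ A ⊆ L, (∀ v ∈ A, ∃ S ∈ 𝒮 v, S ⊆ B ∧ Disjoint (F v S) B) ∧
      (M + 1) * #B < 4 * a * C * #A := by
  set Bs : (V → Fin (M + 1)) → Finset V := fun f => {u ∈ W | f u = 0} with hBs
  set ev : Finset V → Finset V → Finset (V → Fin (M + 1)) :=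
    fun S F => {f | (∀ u ∈ S, f u = 0) ∧ ∀ u ∈ F, f u ≠ 0} with hev
  set As : (V → Fin (M + 1)) → Finset V := fun f => {v ∈ L | ∃ S ∈ 𝒮 v, f ∈ ev S (F v S)} with hAs
  set T := (M + 1) ^ Fintype.card V with hT
  have hB : ∑ f, (M + 1) * #(Bs f) = #W * T := by
    have h1 : ∀ u ∈ W, (M + 1) * #{f : V → Fin (M + 1) | f u = 0} = T := by
      intro u _
      simpa [hT] using pow_card_mul_card_filter_fun M (disjoint_empty_right ({u} : Finset V))
    have h2 : ∑ f, #(Bs f) = ∑ u ∈ W, #{f : V → Fin (M + 1) | f u = 0} :=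
      sum_card_bipartiteAbove_eq_sum_card_bipartiteBelow
        (s := (univ : Finset (V → Fin (M + 1)))) (t := W) fun (f : V → Fin (M + 1)) u => f u = 0
    rw [← mul_sum, h2, mul_sum, sum_congr rfl h1]
    simp
  have hA : #L * T ≤ 2 * C * ∑ f, #(As f) := by
    have h2 : ∑ f, #(As f) =
        ∑ v ∈ L, #{f : V → Fin (M + 1) | ∃ S ∈ 𝒮 v, f ∈ ev S (F v S)} :=
      sum_card_bipartiteAbove_eq_sum_card_bipartiteBelow
        (s := (univ : Finset (V → Fin (M + 1)))) (t := L) fun f v => ∃ S ∈ 𝒮 v, f ∈ ev S (F v S)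
    rw [h2, mul_sum, ← smul_eq_mul]
    refine card_nsmul_le_sum _ _ _ fun v hv => ?_
    -- The events for distinct `S`, `S'` are disjoint: they have equal size, so `S' \ S` is
    -- nonempty, yet it lies in the set forbidden for `S`. Probabilities therefore add up.
    have h3 : ∑ S ∈ 𝒮 v, #(ev S (F v S)) ≤
        #{f : V → Fin (M + 1) | ∃ S ∈ 𝒮 v, f ∈ ev S (F v S)} := by
      rw [← card_biUnion]
      · refine card_le_card fun f hf => ?_
        simpa using hf
      · intro S hS S' hS' hne
        refine Finset.disjoint_left.mpr fun f hf hf' => ?_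
        simp only [hev, mem_filter, mem_univ, true_and] at hf hf'
        have : ¬ S' ⊆ S := fun hsub => hne
          (eq_of_subset_of_card_le hsub ((hs v hv S hS).1.trans (hs v hv S' hS').1.symm).le).symm
        obtain ⟨u, hu', hu⟩ := not_subset.mp this
        exact hf.2 u (hF v hv S hS S' hS' (mem_sdiff.mpr ⟨hu', hu⟩)) (hf'.1 u hu')
    have h4 : ∀ S ∈ 𝒮 v, T ≤ 2 * ((M + 1) ^ s * #(ev S (F v S))) := by
      intro S hS
      obtain ⟨hSc, -, hdis, hFc⟩ := hs v hv S hS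
      rw [← hSc, pow_card_mul_card_filter_fun M hdis, hT, ← card_add_card_compl (F v S), pow_add,
        ← mul_assoc]
      exact Nat.mul_le_mul_right _ (pow_le_two_mul_pow_of_two_mul_le hFc)
    have h5 : #(𝒮 v) * T ≤ 2 * ((M + 1) ^ s * ∑ S ∈ 𝒮 v, #(ev S (F v S))) := by
      rw [mul_sum, mul_sum, ← smul_eq_mul]
      exact card_nsmul_le_sum _ _ _ h4
    have hpos : 0 < (M + 1) ^ s := by positivity
    refine Nat.le_of_mul_le_mul_left ?_ hpos
    calc (M + 1) ^ s * T ≤ C * #(𝒮 v) * T := Nat.mul_le_mul_right _ (hC v hv)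
      _ = C * (#(𝒮 v) * T) := by ring
      _ ≤ C * (2 * ((M + 1) ^ s * ∑ S ∈ 𝒮 v, #(ev S (F v S)))) := Nat.mul_le_mul_left _ h5
      _ ≤ C * (2 * ((M + 1) ^ s * #{f : V → Fin (M + 1) | ∃ S ∈ 𝒮 v, f ∈ ev S (F v S)})) := by
        gcongr
      _ = _ := by ring
  obtain ⟨f, -, hf⟩ : ∃ f ∈ (univ : Finset (V → Fin (M + 1))),
      (M + 1) * #(Bs f) < 4 * a * C * #(As f) := by
    refine exists_lt_of_sum_lt ?_
    have hTpos : 0 < T := by positivity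
    have hLpos := hL.card_pos
    rw [hB, ← mul_sum]
    calc #W * T ≤ a * #L * T := Nat.mul_le_mul_right _ hW
      _ < 2 * (a * (#L * T)) := by
        have : 0 < a * (#L * T) := by positivity
        linarith
      _ ≤ 2 * (a * (2 * C * ∑ f, #(As f))) := by gcongr
      _ = _ := by ring
  refine ⟨Bs f, filter_subset _ _, As f, filter_subset _ _, fun v hv => ?_, hf⟩
  obtain ⟨hvL, S, hS, hfS⟩ := mem_filter.mp hv
  simp only [hev, mem_filter, mem_univ, true_and] at hfS
  refine ⟨S, hS, fun u hu => mem_filter.mpr ⟨(hs v hvL S hS).2.1 hu, hfS.1 u hu⟩, ?_⟩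
  exact Finset.disjoint_left.mpr fun u hu hu' => hfS.2 u hu (mem_filter.mp hu').2

namespace SimpleGraph

variable {V : Type u}

/-! ### Graphs with large independent sets -/

/-- Every set of large minimum degree contains a degenerate subset, most of whose vertices have
degree within a constant factor of the degeneracy. -/
theorem exists_almost_regular (G : SimpleGraph V) {D : ℕ} (hD : D ≠ 0) {U : Finset V}
    (hU : U.Nonempty) (hdeg : ∀ v ∈ U, D ≤ #(G.nbrsIn U v)) :
    ∃ W : Finset V, W.Nonempty ∧ ∃ δ ≥ D, (∀ v ∈ W, δ ≤ 4 * #(G.nbrsIn W v)) ∧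
      #W ≤ 2 * #{v ∈ W | #(G.nbrsIn W v) ≤ 2 * δ} ∧
      ∀ T ⊆ W, T.Nonempty → ∃ v ∈ T, #(G.nbrsIn T v) ≤ δ := by
  obtain ⟨W, hWU, hW, ρ, hWρ, hT, hmin⟩ := G.exists_max_density hU
  have hDρ : (D : ℝ) ≤ ρ := by
    refine le_of_mul_le_mul_right (le_trans ?_ (hT U le_rfl)) (Nat.cast_pos.mpr hU.card_pos)
    have := card_nsmul_le_sum U (fun v => #(G.nbrsIn U v)) D hdeg
    rw [smul_eq_mul, mul_comm] at this
    exact_mod_cast this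
  -- Ensures `⌈ρ⌉₊ ≤ 2 * ρ`, so that rounding costs only a factor two.
  have hρ1 : 1 ≤ ρ := le_trans (by exact_mod_cast Nat.one_le_iff_ne_zero.mpr hD) hDρ
  have hρδ : ρ ≤ ⌈ρ⌉₊ := Nat.le_ceil ρ
  have hδρ : (⌈ρ⌉₊ : ℝ) < ρ + 1 := Nat.ceil_lt_add_one (by linarith)
  have hδT : ∀ T ⊆ W, ∑ v ∈ T, #(G.nbrsIn T v) ≤ ⌈ρ⌉₊ * #T := by
    intro T hTW
    have h1 : ∑ v ∈ T, (#(G.nbrsIn T v) : ℝ) ≤ ⌈ρ⌉₊ * #T :=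
      (hT T (hTW.trans hWU)).trans (mul_le_mul_of_nonneg_right hρδ (Nat.cast_nonneg _))
    exact_mod_cast h1
  refine ⟨W, hW, ⌈ρ⌉₊, by exact_mod_cast hDρ.trans hρδ, fun v hv => ?_, ?_, fun T hTW hne => ?_⟩
  · have h1 := hmin v hv
    have : (⌈ρ⌉₊ : ℝ) ≤ 4 * #(G.nbrsIn W v) := by linarith
    exact_mod_cast this
  · set δ := ⌈ρ⌉₊
    have hδ : 0 < δ := Nat.ceil_pos.mpr (by linarith)
    have hsplit := card_filter_add_card_filter_not (s := W) (fun v => #(G.nbrsIn W v) ≤ 2 * δ)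
    have h1 : #{v ∈ W | ¬ #(G.nbrsIn W v) ≤ 2 * δ} * (2 * δ) ≤ ∑ v ∈ W, #(G.nbrsIn W v) := by
      rw [← smul_eq_mul]
      refine (card_nsmul_le_sum _ (fun v => #(G.nbrsIn W v)) _ fun v hv => ?_).trans
        (sum_le_sum_of_subset (filter_subset _ _))
      exact (not_le.mp (mem_filter.mp hv).2).le
    have h2 := h1.trans (hδT W le_rfl)
    have h3 : 2 * #{v ∈ W | ¬ #(G.nbrsIn W v) ≤ 2 * δ} ≤ #W :=
      Nat.le_of_mul_le_mul_left (by linarith) hδ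
    omega
  · refine exists_le_of_sum_le hne ((hδT T hTW).trans ?_)
    simp [mul_comm]

theorem exists_card_le_mul_card_nbrsIn {k : ℕ} {G : SimpleGraph V} {F : Fin k → SimpleGraph V}
    (hGF : ∀ u v, G.Adj u v → ∃ i, (F i).Adj u v) (W : Finset V) {v : V}
    (hv : #(G.nbrsIn W v) ≠ 0) : ∃ i, #(G.nbrsIn W v) ≤ k * #((F i).nbrsIn W v) := by
  have h1 : #(G.nbrsIn W v) ≤ ∑ i, #((F i).nbrsIn W v) := by
    refine (card_le_card fun u hu => ?_).trans card_biUnion_le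
    obtain ⟨hu, hadj⟩ := mem_nbrsIn.mp hu
    obtain ⟨i, hi⟩ := hGF v u hadj
    exact mem_biUnion.mpr ⟨i, mem_univ i, mem_nbrsIn.mpr ⟨hu, hi⟩⟩
  by_contra! hcon
  rcases k.eq_zero_or_pos with rfl | hk
  · simp at h1
    simp [h1] at hv
  · have h2 : ∑ i : Fin k, k * #((F i).nbrsIn W v) < ∑ _i : Fin k, #(G.nbrsIn W v) :=
      sum_lt_sum_of_nonempty ⟨⟨0, hk⟩, mem_univ _⟩ fun i _ => hcon i
    rw [← mul_sum, sum_const, card_univ, Fintype.card_fin, smul_eq_mul] at h2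
    have := Nat.mul_le_mul_left k h1
    omega

theorem exists_card_le_mul_card_fiber {k : ℕ} (hk : 0 < k) (L : Finset V) (f : V → Fin k) :
    ∃ i, #L ≤ k * #{v ∈ L | f v = i} := by
  obtain ⟨i, -, hi⟩ : ∃ i ∈ (univ : Finset (Fin k)), #L ≤ k * #{v ∈ L | f v = i} := by
    refine exists_le_of_sum_le ⟨⟨0, hk⟩, mem_univ _⟩ ?_
    rw [← mul_sum, ← card_eq_sum_card_fiberwise fun v _ => mem_univ (f v)]
    simp
  exact ⟨i, hi⟩

/-- An edge count in an induced bipartite subgraph, all of whose edges go to `F`. -/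
theorem exists_le_card_nbrsIn_of_bipartite {G F : SimpleGraph V} {A B : Finset V} {d : ℕ}
    (hA : G.IsIndepSet (A : Set V)) (hB : G.IsIndepSet (B : Set V)) (hdis : Disjoint A B)
    (hne : A.Nonempty) (hBA : #B ≤ #A) (hdeg : ∀ v ∈ A, 2 * d ≤ #(G.nbrsIn B v))
    (hF : ∀ v ∈ A, ∀ u ∈ B, G.Adj v u → F.Adj v u) :
    ∃ H : Finset V, H.Nonempty ∧ (∀ u ∈ H, ∀ v ∈ H, G.Adj u v → F.Adj u v) ∧
      ∀ v ∈ H, d ≤ #(G.nbrsIn H v) := by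
  have h1 : #A * (2 * d) ≤ ∑ v ∈ A, #(G.nbrsIn B v) := card_nsmul_le_sum A _ _ hdeg
  have h2 : 2 * d * #(A ∪ B) ≤ ∑ v ∈ A ∪ B, #(G.nbrsIn (A ∪ B) v) := by
    have h3 : ∑ v ∈ A, #(G.nbrsIn B v) ≤ ∑ v ∈ A, #(G.nbrsIn (A ∪ B) v) :=
      sum_le_sum fun v _ => card_le_card (G.nbrsIn_mono subset_union_right v)
    have h4 : ∑ v ∈ B, #(G.nbrsIn A v) ≤ ∑ v ∈ B, #(G.nbrsIn (A ∪ B) v) :=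
      sum_le_sum fun v _ => card_le_card (G.nbrsIn_mono subset_union_left v)
    rw [sum_card_nbrsIn_comm] at h4
    rw [sum_union hdis, card_union_of_disjoint hdis]
    have := Nat.mul_le_mul_left (2 * d) hBA
    linarith
  obtain ⟨H, hH, hHne, hHd⟩ := G.exists_le_card_nbrsIn (hne.mono subset_union_left) h2
  refine ⟨H, hHne, fun u hu v hv huv => ?_, hHd⟩
  rcases mem_union.mp (hH hu) with hu | hu <;> rcases mem_union.mp (hH hv) with hv | hv
  · exact absurd huv (hA (mem_coe.mpr hu) (mem_coe.mpr hv) huv.ne)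
  · exact hF u hu v hv huv
  · exact (hF v hv u hu huv.symm).symm
  · exact absurd huv (hB (mem_coe.mpr hu) (mem_coe.mpr hv) huv.ne)

/-- The Ramsey-type theorem for graphs in which large sets contain large independent sets. -/
theorem exists_monochromatic_of_hasIndepSets (k d : ℕ) (r : ℕ → ℕ) :
    ∃ D, ∀ (V : Type u) [Fintype V] (G : SimpleGraph V) (F : Fin k → SimpleGraph V),
      (∀ u v, G.Adj u v → ∃ i, (F i).Adj u v) → (∀ i, F i ≤ G) →
      (∀ t, G.HasIndepSets (r t) t) →
      ∀ U : Finset V, U.Nonempty → (∀ v ∈ U, D ≤ #(G.nbrsIn U v)) →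
        ∃ i, ∃ H : Finset V, H.Nonempty ∧ (∀ u ∈ H, ∀ v ∈ H, G.Adj u v → (F i).Adj u v) ∧
          ∀ v ∈ H, d ≤ #(G.nbrsIn H v) := by
  rcases k.eq_zero_or_pos with rfl | hk
  · refine ⟨1, fun V _ G F hGF _ _ U hU hdeg => ?_⟩
    obtain ⟨v, hv⟩ := hU
    obtain ⟨u, hu⟩ := card_pos.mp (hdeg v hv)
    obtain ⟨i, -⟩ := hGF v u (mem_nbrsIn.mp hu).2
    exact i.elim0
  set s := 2 * d with hs
  obtain ⟨c, hc, M, hM⟩ := exists_pow_le_mul_card_indepSubsets.{u} (r s) s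
  set C := (8 * k * (s + 3)) ^ s * c with hC
  have hCpos : 0 < C := by positivity
  -- Chosen so that `(N + 1) * #B < 8 * k * C * #A` and `K * #A ≤ 4 * δ * #A'` together give `#B ≤
  -- #A'`.
  set K := 16 * (2 * k) * C with hK
  have hKpos : 0 < K := by positivity
  obtain ⟨Δ₀, hΔ₀⟩ := exists_large_isIndepSet.{u} (r (4 * K)) K hKpos.ne'
  -- The summands ensure `δ > 0`, at least `M` neighbours in the majority colour, and `2 * δ ≥ Δ₀`.
  refine ⟨1 + 4 * k * M + Δ₀, fun V _ G F hGF hFG hr U hU hdeg => ?_⟩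
  obtain ⟨W, hW, δ, hδ, hδW, hWL, hdegen⟩ := G.exists_almost_regular (by omega) hU hdeg
  obtain ⟨o, ho, hcov⟩ := G.exists_orientation W hdegen
  set L₀ : Finset V := {v ∈ W | #(G.nbrsIn W v) ≤ 2 * δ} with hL₀
  have hcol : ∀ v : V, ∃ i, v ∈ W → #(G.nbrsIn W v) ≤ k * #((F i).nbrsIn W v) := by
    intro v
    by_cases hv : v ∈ W
    · obtain ⟨i, hi⟩ := exists_card_le_mul_card_nbrsIn (v := v) hGF W
        (by have := hδW v hv; omega)
      exact ⟨i, fun _ => hi⟩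
    · exact ⟨⟨0, hk⟩, fun h => absurd h hv⟩
  choose col hcol using hcol
  obtain ⟨i, hi⟩ := exists_card_le_mul_card_fiber hk L₀ col
  set L : Finset V := {v ∈ L₀ | col v = i} with hL
  have hWL' : #W ≤ 2 * k * #L := by linarith
  have hLne : L.Nonempty := by
    rw [← card_pos]
    have := hW.card_pos
    exact Nat.pos_of_mul_pos_left (by omega : 0 < 2 * k * #L)
  have hLW : ∀ v ∈ L, v ∈ W ∧ #(G.nbrsIn W v) ≤ 2 * δ ∧ δ ≤ 4 * k * #((F i).nbrsIn W v) := by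
    intro v hv
    obtain ⟨hv, hvi⟩ := mem_filter.mp hv
    obtain ⟨hv, hvd⟩ := mem_filter.mp hv
    refine ⟨hv, hvd, ?_⟩
    have h1 := hcol v hv
    have h2 := hδW v hv
    rw [hvi] at h1
    linarith
  set 𝒮 : V → Finset (Finset V) := fun v =>
    {Y ∈ G.indepSubsets ((F i).nbrsIn W v) | #Y = s} with h𝒮
  -- Forbidding `v` makes `A` and `B` disjoint, forbidding its other neighbours leaves only edges of
  -- colour `i` to `B`, and forbidding the out-neighbours of `S` puts `S` into `B'`.
  set Φ : V → Finset V → Finset V := fun v S =>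
    (insert v (G.nbrsIn W v) ∪ S.biUnion o) \ S with hΦ
  -- `Φ v S` has at most `2 * δ + 1 + s * δ ≤ (s + 3) * δ` elements, hence is avoided with
  -- probability at least `1 / 2`.
  obtain ⟨N, hN⟩ : ∃ N, N + 1 = 2 * ((s + 3) * δ) :=
    ⟨2 * ((s + 3) * δ) - 1, by
      have : 0 < (s + 3) * δ := Nat.mul_pos (by omega) (by omega)
      omega⟩
  have hmem : ∀ v, ∀ S ∈ 𝒮 v, #S = s ∧ G.IsIndepSet (S : Set V) ∧
      ∀ u ∈ S, u ∈ W ∧ (F i).Adj v u := by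
    intro v S hS
    obtain ⟨hS, hSc⟩ := mem_filter.mp hS
    obtain ⟨hS, hSi⟩ := mem_indepSubsets.mp hS
    exact ⟨hSc, hSi, fun u hu => mem_nbrsIn.mp (hS hu)⟩
  obtain ⟨B, hBW, A, hAL, hAB, hcard⟩ := exists_selection (W := W) hLne (M := N) (s := s) (C := C)
    (a := 2 * k) 𝒮 Φ (by
      intro v hv S hS
      obtain ⟨hSc, -, hSW⟩ := hmem v S hS
      refine ⟨hSc, fun u hu => (hSW u hu).1, disjoint_sdiff, ?_⟩
      have h1 : #(S.biUnion o) ≤ s * δ := by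
        rw [← hSc]
        exact card_biUnion_le_card_mul _ _ _ fun u _ => (ho u).1
      have h2 : #(insert v (G.nbrsIn W v)) ≤ 2 * δ + 1 :=
        (card_insert_le _ _).trans (by have := (hLW v hv).2.1; omega)
      have h3 : #(Φ v S) ≤ #(insert v (G.nbrsIn W v)) + #(S.biUnion o) :=
        (card_le_card sdiff_subset).trans (card_union_le _ _)
      have h4 : (s + 3) * δ = s * δ + 3 * δ := by ring
      omega) (by
      intro v hv S hS S' hS' u hu
      obtain ⟨hu, huS⟩ := mem_sdiff.mp hu
      obtain ⟨huW, hadj⟩ := (hmem v S' hS').2.2 u hu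
      refine mem_sdiff.mpr ⟨mem_union_left _ (mem_insert_of_mem ?_), huS⟩
      exact mem_nbrsIn.mpr ⟨huW, hFG i hadj⟩) (by
      intro v hv
      have hm := (hLW v hv).2.2
      have h1 : M ≤ #((F i).nbrsIn W v) :=
        Nat.le_of_mul_le_mul_left (by omega : 4 * k * M ≤ 4 * k * _) (by omega)
      have h2 := hM (hr s) _ h1
      calc (N + 1) ^ s ≤ (8 * k * (s + 3) * #((F i).nbrsIn W v)) ^ s := by
            rw [hN]
            refine Nat.pow_le_pow_left ?_ s
            calc 2 * ((s + 3) * δ) ≤ 2 * ((s + 3) * (4 * k * #((F i).nbrsIn W v))) := by gcongr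
              _ = _ := by ring
        _ = (8 * k * (s + 3)) ^ s * #((F i).nbrsIn W v) ^ s := mul_pow _ _ _
        _ ≤ (8 * k * (s + 3)) ^ s * (c * #(𝒮 v)) := Nat.mul_le_mul_left _ h2
        _ = _ := by rw [hC]; ring) (by omega) hWL'
  have hAne : 0 < #A := Nat.pos_of_mul_pos_left (lt_of_le_of_lt (Nat.zero_le _) hcard)
  obtain ⟨A', hA'A, hA'i, hA'c⟩ := hΔ₀ (hr (4 * K)) (2 * δ) (by omega) A fun v hv =>
    (card_le_card (G.nbrsIn_mono (fun u hu => (hLW u (hAL hu)).1) v)).trans (hLW v (hAL hv)).2.1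
  have hA'ne : A'.Nonempty := by
    rw [← card_pos]
    exact Nat.pos_of_mul_pos_left (lt_of_lt_of_le (Nat.mul_pos hKpos hAne) hA'c)
  have hBA' : #B ≤ #A' := by
    have hδpos : 0 < δ := by omega
    refine Nat.le_of_mul_le_mul_left (?_ : δ * #B ≤ δ * #A') hδpos
    rw [hN] at hcard
    have h1 : δ * #B ≤ 2 * ((s + 3) * δ) * #B := Nat.mul_le_mul_right _ (by nlinarith)
    rw [hK] at hA'c
    linarith
  set B' : Finset V := {b ∈ B | Disjoint (o b) B} with hB'
  have hB'i : G.IsIndepSet (B' : Set V) := by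
    intro a ha b hb _ hab
    obtain ⟨haB, ha⟩ := mem_filter.mp (mem_coe.mp ha)
    obtain ⟨hbB, hb⟩ := mem_filter.mp (mem_coe.mp hb)
    rcases hcov a (hBW haB) b (hBW hbB) hab with h | h
    · exact Finset.disjoint_left.mp hb h haB
    · exact Finset.disjoint_left.mp ha h hbB
  have hkey : ∀ v ∈ A, v ∉ B ∧ 2 * d ≤ #(G.nbrsIn B' v) ∧ ∀ u ∈ B, G.Adj v u → (F i).Adj v u := by
    intro v hv
    obtain ⟨S, hS, hSB, hdis⟩ := hAB v hv
    obtain ⟨hSc, hSi, hSW⟩ := hmem v S hS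
    refine ⟨fun hvB => ?_, ?_, fun u huB huv => ?_⟩
    · refine Finset.disjoint_left.mp hdis (mem_sdiff.mpr ⟨?_, fun hvS => ?_⟩) hvB
      · exact mem_union_left _ (mem_insert_self _ _)
      · exact (hSW v hvS).2.ne rfl
    · rw [← hs, ← hSc]
      refine card_le_card fun b hb => mem_nbrsIn.mpr ⟨?_, hFG i (hSW b hb).2⟩
      refine mem_filter.mpr ⟨hSB hb, Finset.disjoint_left.mpr fun x hx hxB => ?_⟩
      have hbx := (ho b).2 x hx
      refine Finset.disjoint_left.mp hdis (mem_sdiff.mpr ⟨?_, fun hxS => ?_⟩) hxB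
      · exact mem_union_right _ (mem_biUnion.mpr ⟨b, hb, hx⟩)
      · exact hSi (mem_coe.mpr hb) (mem_coe.mpr hxS) hbx.ne hbx
    · by_cases huS : u ∈ S
      · exact (hSW u huS).2
      · refine absurd huB (Finset.disjoint_left.mp hdis (mem_sdiff.mpr ⟨?_, huS⟩))
        exact mem_union_left _ (mem_insert_of_mem (mem_nbrsIn.mpr ⟨hBW huB, huv⟩))
  refine ⟨i, exists_le_card_nbrsIn_of_bipartite hA'i hB'i ?_ hA'ne
    ((card_le_card (filter_subset _ _)).trans hBA') (fun v hv => (hkey v (hA'A hv)).2.1)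
    fun v hv u hu => (hkey v (hA'A hv)).2.2 u (mem_filter.mp hu).1⟩
  exact Finset.disjoint_left.mpr fun v hv hvB => (hkey v (hA'A hv)).1 (mem_filter.mp hvB).1

/-! ### The Ramsey dichotomy and the passage to subgraphs -/

/-- Every graph of large minimum degree whose edges are covered by `k` subgraphs has an induced
subgraph of minimum degree at least `d` lying in one of them. -/
theorem exists_monochromatic_induced (k d : ℕ) :
    ∃ D, ∀ (V : Type u) [Fintype V] [Nonempty V] (G : SimpleGraph V) (F : Fin k → SimpleGraph V),
      (∀ u v, G.Adj u v → ∃ i, (F i).Adj u v) → (∀ i, F i ≤ G) →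
      (∀ v, D ≤ #(G.nbrsIn univ v)) →
        ∃ H : Finset V, H.Nonempty ∧
          (∃ i, ∀ u ∈ H, ∀ v ∈ H, G.Adj u v → (F i).Adj u v) ∧
          ∀ v ∈ H, d ≤ #(G.nbrsIn H v) := by
  -- The index `none` stands for the complement of `G`, with target `t`; each colour has target `d +
  -- 1`, the size of a clique of minimum degree `d`.
  choose r hr using fun t : ℕ => exists_isClique_of_covering.{u} fun o : Option (Fin k) =>
    o.elim t fun _ => d + 1
  obtain ⟨D, hD⟩ := exists_monochromatic_of_hasIndepSets.{u} k d r
  refine ⟨D, fun V _ _ G F hGF hFG hdeg => ?_⟩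
  by_cases hcl : ∃ i, ∃ H : Finset V, #H = d + 1 ∧ (F i).IsClique (H : Set V)
  · obtain ⟨i, H, hHc, hH⟩ := hcl
    refine ⟨H, card_pos.mp (by omega), ⟨i, fun u hu v hv huv =>
      hH (mem_coe.mpr hu) (mem_coe.mpr hv) huv.ne⟩, fun v hv => ?_⟩
    have h1 : #(H.erase v) = d := by rw [card_erase_of_mem hv, hHc, Nat.add_sub_cancel]
    rw [← h1]
    refine card_le_card fun u hu => mem_nbrsIn.mpr ⟨mem_of_mem_erase hu, hFG i ?_⟩
    exact hH (mem_coe.mpr hv) (mem_coe.mpr (mem_of_mem_erase hu)) (ne_of_mem_erase hu).symm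
  · have hind : ∀ t, G.HasIndepSets (r t) t := by
      intro t X hX
      obtain ⟨o, S, hSX, hSc, hS⟩ := hr t V (fun o => o.elim Gᶜ F) (fun u v huv => by
        by_cases h : G.Adj u v
        · obtain ⟨i, hi⟩ := hGF u v h
          exact ⟨some i, hi⟩
        · exact ⟨none, (G.compl_adj u v).mpr ⟨huv, h⟩⟩) X hX
      match o with
      | none => exact ⟨S, hSX, hSc, fun a ha b hb hab => ((G.compl_adj a b).mp (hS ha hb hab)).2⟩
      | some i => exact absurd ⟨i, S, hSc, hS⟩ hcl
    obtain ⟨i, H, hHne, hmono, hH⟩ := hD V G F hGF hFG hind univ univ_nonempty fun v _ => hdeg v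
    exact ⟨H, hHne, ⟨i, hmono⟩, hH⟩

end SimpleGraph

end InducedMonochromatic

open Classical in
theorem theorem1p1 :
    ∃ f : ℕ → ℕ → ℕ, ∀ (k d : ℕ) (V : Type*) [Fintype V] [Nonempty V]
      (G : SimpleGraph V) (φ : G.EdgeLabeling (Fin k)),
      f k d ≤ G.minDegree →
        ∃ H : G.Subgraph, H.verts.Nonempty ∧ H.IsInduced ∧ IsMonochromaticSubgraph φ H ∧
          d ≤ H.coe.minDegree := by
  choose f hf using SimpleGraph.exists_monochromatic_induced
  refine ⟨f, fun k d V _ _ G φ hmin => ?_⟩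
  obtain ⟨H, hHne, ⟨i, hi⟩, hH⟩ := hf k d V G φ.labelGraph
    (fun u v huv => ⟨φ ⟨s(u, v), huv⟩, (φ.labelGraph_adj u v).mpr ⟨huv, rfl⟩⟩)
    (fun _ => φ.labelGraph_le) (fun v => by
      refine hmin.trans ((G.minDegree_le_degree v).trans (Finset.card_le_card fun u hu => ?_))
      exact SimpleGraph.mem_nbrsIn.mpr ⟨Finset.mem_univ u, (G.mem_neighborFinset v u).mp hu⟩)
  have hcol : ∀ (e : Sym2 V) (he : e ∈ ((⊤ : G.Subgraph).induce (H : Set V)).edgeSet),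
      φ ⟨e, ((⊤ : G.Subgraph).induce (H : Set V)).edgeSet_subset he⟩ = i := by
    intro e
    induction e using Sym2.ind with
    | _ u v =>
      intro he
      rw [SimpleGraph.Subgraph.mem_edgeSet, SimpleGraph.Subgraph.induce_adj] at he
      obtain ⟨hu, hv, huv⟩ := he
      obtain ⟨_, h⟩ := (φ.labelGraph_adj u v).mp (hi u hu v hv huv)
      exact h
  obtain ⟨S, hS⟩ : ∃ S, S = (⊤ : G.Subgraph).induce (H : Set V) := ⟨_, rfl⟩
  have hverts : ∀ u, u ∈ S.verts ↔ u ∈ H := fun u => by simp [hS]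
  have hadj : ∀ u v, S.Adj u v ↔ u ∈ H ∧ v ∈ H ∧ G.Adj u v := fun u v => by simp [hS]
  refine ⟨S, hHne.imp fun u => (hverts u).mpr, ?_, ?_, ?_⟩
  · intro u hu v hv huv
    exact (hadj u v).mpr ⟨(hverts u).mp hu, (hverts v).mp hv, huv⟩
  · subst hS
    intro e e' he he'
    rw [hcol e he, hcol e' he']
  · have : Nonempty S.verts := let ⟨u, hu⟩ := hHne; ⟨⟨u, (hverts u).mpr hu⟩⟩
    refine SimpleGraph.le_minDegree_of_forall_le_degree _ _ fun v => ?_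
    refine (hH v ((hverts v).mp v.2)).trans ?_
    rw [← SimpleGraph.card_neighborFinset_eq_degree]
    refine Finset.card_le_card_of_surjOn (fun w => (w : V)) fun u hu => ?_
    obtain ⟨huH, huv⟩ := SimpleGraph.mem_nbrsIn.mp (Finset.mem_coe.mp hu)
    refine ⟨⟨u, (hverts u).mpr huH⟩, ?_, rfl⟩
    rw [Finset.mem_coe, SimpleGraph.mem_neighborFinset]
    exact (hadj v u).mpr ⟨(hverts v).mp v.2, huH, huv⟩
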